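/- Let $q:(0,\pi)\to\mathbb{R}$ be summable (Lebesgue integrable), $\gamma\in(0,\pi]$ and $\delta\in[0,\pi)$. Let $L(q,\gamma,\delta)$ be the Sturm--Liouville operator in $L^2(0,\pi)$ (with complex-valued functions) acting by $y\mapsto -y''+q\,y$ on those $y$ for which $y$ and $y'$ are absolutely continuous on $[0,\pi]$, $-y''+qy\in L^2(0,\pi)$, and $$y(0)\cos\gamma+y'(0)\sin\gamma=0,\qquad y(\pi)\cos\delta+y'(\pi)\sin\delta=0.$$ Then all eigenvalues of $L(q,\gamma,\delta)$ are real and there is a lowest one, denoted $\mu_0(q,\gamma,\delta)$; the same holds for $L(0,\gamma,\delta)$, the operator with zero potential; and $$\operatorname*{ess\,inf}_{(0,\pi)} q\;\le\;\mu_0(q,\gamma,\delta)-\mu_0(0,\gamma,\delta)\;\le\;\operatorname*{ess\,sup}_{(0,\pi)} q,$$ where the essential infimum and supremum are taken with respect to Lebesgue measure in the extended reals $[-\infty,+\infty]$. -/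

import Mathlib

open MeasureTheory

namespace SturmLiouville

/-- The derivative `y'` of a function on `[0, π]`, one-sided at the endpoints. -/
noncomputable def D (y : ℝ → ℂ) : ℝ → ℂ :=
  derivWithin y (Set.Icc 0 Real.pi)

/-- Lebesgue measure on the interval `(0, π)`. -/
noncomputable def vol : Measure ℝ := volume.restrict (Set.Ioo 0 Real.pi)

/-- The differential expression `-y'' + q y`. It is used only where `y'` is absolutely continuous
on `[0, π]`, so that `y''` exists almost everywhere. -/
noncomputable def expr (q : ℝ → ℝ) (y : ℝ → ℂ) (x : ℝ) : ℂ :=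
  -deriv (D y) x + (q x : ℂ) * y x

/-- The domain of the operator `L(q, γ, δ)` in `L²(0, π)`: the functions `y` that are
differentiable on `[0, π]` with `y'` absolutely continuous there, with `-y'' + q y ∈ L²(0, π)`, and
that satisfy the two boundary conditions. -/
structure InDomain (q : ℝ → ℝ) (γ δ : ℝ) (y : ℝ → ℂ) : Prop where
  differentiableOn : DifferentiableOn ℝ y (Set.Icc 0 Real.pi)
  absolutelyContinuous : AbsolutelyContinuousOnInterval (D y) 0 Real.pi
  memLp : MemLp (expr q y) 2 vol
  boundary_left : y 0 * (Real.cos γ : ℂ) + D y 0 * (Real.sin γ : ℂ) = 0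
  boundary_right : y Real.pi * (Real.cos δ : ℂ) + D y Real.pi * (Real.sin δ : ℂ) = 0

/-- `μ ∈ ℂ` is an eigenvalue of `L(q, γ, δ)`: there is a `y` in the domain, not identically zero
on `[0, π]`, with `-y'' + q y = μ y` almost everywhere on `(0, π)`. -/
def IsEigenvalue (q : ℝ → ℝ) (γ δ : ℝ) (μ : ℂ) : Prop :=
  ∃ y : ℝ → ℂ, InDomain q γ δ y ∧ (∃ x ∈ Set.Icc 0 Real.pi, y x ≠ 0) ∧
    ∀ᵐ x ∂vol, expr q y x = μ * y x

/-- The real number `m` is the lowest eigenvalue of `L(q, γ, δ)`: it is an eigenvalue, and every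
eigenvalue is real and at least `m`. -/
def IsLowestEigenvalue (q : ℝ → ℝ) (γ δ : ℝ) (m : ℝ) : Prop :=
  IsEigenvalue q γ δ (m : ℂ) ∧ ∀ μ : ℂ, IsEigenvalue q γ δ μ → μ.im = 0 ∧ m ≤ μ.re

/-- `μ₀(q, γ, δ)`, as the infimum of the real eigenvalues. That this infimum is attained, and is
the lowest eigenvalue, is expressed by `IsLowestEigenvalue q γ δ (mu0 q γ δ)`. -/
noncomputable def mu0 (q : ℝ → ℝ) (γ δ : ℝ) : ℝ :=
  sInf {m : ℝ | IsEigenvalue q γ δ (m : ℂ)}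

end SturmLiouville

namespace SturmLiouville

open Set Filter Topology

/-! Let `Q` be a primitive of `q`. With the quasi-derivative `u = y' - Q y`, the equation `-y'' + q
y = l y` becomes a linear system whose coefficients are continuous although `q` is merely
integrable, so classical arguments for solutions that are differentiable everywhere apply.

Existence of a lowest eigenvalue is a shooting argument. Start solutions from the left boundary
condition and take the supremum of the parameters for which the solution is positive on `(0, π]`
with a positive boundary form at `π`. At the supremum the boundary form vanishes and the solution is
still positive inside (`exists_pos_eigenpair`). Wronskians then show that every eigenvalue is real
and none is smaller (`le_of_sol`, `IsEigenvalue.im_eq_zero_and_le`).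

For the bounds, let `y, z > 0` be the ground states for `q` and for `0`, and `d` the difference of
their eigenvalues. Integrating `(y' z - y z')'` gives `∫ (q - d) y z = 0`, because the boundary
terms cancel (`integral_potential_diff_eq_zero`). So `d` is a mean of `q` with positive weight `y
z`, and `q - d` is neither a.e. positive nor a.e. negative. -/

/-- `(y, u)` solves on `[0, π]` the system that `-y'' + Q' y = l y` becomes for the
quasi-derivative `u = y' - Q y`. -/
structure Sol (Q : ℝ → ℝ) (l : ℝ) (y u : ℝ → ℝ) : Prop where
  deriv_fst : ∀ x ∈ Icc 0 Real.pi,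
    HasDerivWithinAt y (Q x * y x + u x) (Icc 0 Real.pi) x
  deriv_snd : ∀ x ∈ Icc 0 Real.pi,
    HasDerivWithinAt u (-(l + Q x ^ 2) * y x - Q x * u x) (Icc 0 Real.pi) x

/-! ### The initial value problem: existence, continuous dependence, uniqueness. -/

/-- The right-hand side of the system solved by a quasi-derivative pair. -/
def field (Q l : ℝ) (p : ℝ × ℝ) : ℝ × ℝ :=
  (Q * p.1 + p.2, -(l + Q ^ 2) * p.1 - Q * p.2)

theorem norm_field_le {Q l M : ℝ} (hQ : |Q| ≤ M) (p : ℝ × ℝ) :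
    ‖field Q l p‖ ≤ (M + 1 + |l| + M ^ 2) * ‖p‖ := by
  have hM : 0 ≤ M := (abs_nonneg _).trans hQ
  have h1 : |p.1| ≤ ‖p‖ := norm_fst_le p
  have h2 : |p.2| ≤ ‖p‖ := norm_snd_le p
  have hp := norm_nonneg p
  have hl := abs_nonneg l
  have hQ2 : |l + Q ^ 2| ≤ |l| + M ^ 2 := by
    refine (abs_add_le _ _).trans ?_
    rw [abs_pow]
    gcongr
  refine max_le ?_ ?_
  · calc |Q * p.1 + p.2| ≤ |Q| * |p.1| + |p.2| := by
          rw [← abs_mul]; exact abs_add_le _ _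
      _ ≤ M * ‖p‖ + ‖p‖ := by gcongr
      _ ≤ _ := by nlinarith [mul_nonneg hl hp, mul_nonneg (sq_nonneg M) hp]
  · calc |(-(l + Q ^ 2) * p.1 - Q * p.2)| ≤ |l + Q ^ 2| * |p.1| + |Q| * |p.2| := by
          rw [← abs_mul, ← abs_mul, neg_mul, ← abs_neg ((l + Q ^ 2) * p.1)]
          exact abs_sub _ _
      _ ≤ (|l| + M ^ 2) * ‖p‖ + M * ‖p‖ := by gcongr
      _ ≤ _ := by nlinarith

theorem field_sub (Q l : ℝ) (p p' : ℝ × ℝ) :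
    field Q l p - field Q l p' = field Q l (p - p') := by
  ext <;> simp [field] <;> ring

theorem exists_abs_le {Q : ℝ → ℝ} (hQ : ContinuousOn Q (Icc 0 Real.pi)) :
    ∃ M, 0 ≤ M ∧ ∀ x ∈ Icc 0 Real.pi, |Q x| ≤ M := by
  obtain ⟨M, hM⟩ := isCompact_Icc.exists_bound_of_continuousOn hQ
  exact ⟨M, (norm_nonneg _).trans (hM 0 ⟨le_rfl, Real.pi_pos.le⟩), hM⟩

theorem hasDerivWithinAt_Ici_of_Icc {E : Type*} [NormedAddCommGroup E] [NormedSpace ℝ E]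
    {f : ℝ → E} {f' : E} {a b x : ℝ} (hx : x ∈ Ico a b)
    (h : HasDerivWithinAt f f' (Icc a b) x) : HasDerivWithinAt f f' (Ici x) x :=
  (h.mono (Icc_subset_Icc_left hx.1)).mono_of_mem_nhdsWithin (Icc_mem_nhdsGE hx.2)

theorem Sol.continuousOn_fst {Q : ℝ → ℝ} {l : ℝ} {y u : ℝ → ℝ} (h : Sol Q l y u) :
    ContinuousOn y (Icc 0 Real.pi) := fun x hx => (h.deriv_fst x hx).continuousWithinAt

theorem Sol.continuousOn_snd {Q : ℝ → ℝ} {l : ℝ} {y u : ℝ → ℝ} (h : Sol Q l y u) :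
    ContinuousOn u (Icc 0 Real.pi) := fun x hx => (h.deriv_snd x hx).continuousWithinAt

theorem Sol.const_mul {Q : ℝ → ℝ} {l : ℝ} {y u : ℝ → ℝ} (h : Sol Q l y u) (c : ℝ) :
    Sol Q l (fun x => c * y x) (fun x => c * u x) where
  deriv_fst x hx := ((h.deriv_fst x hx).const_mul c).congr_deriv (by ring)
  deriv_snd x hx := ((h.deriv_snd x hx).const_mul c).congr_deriv (by ring)

/-- Truncating the unknowns makes the field bounded, so Picard–Lindelöf reaches across all of `[0,
π]` in one application. Gronwall then keeps the solution within the truncation radius, where the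
truncated and the original systems agree. -/
theorem exists_sol {Q : ℝ → ℝ} (hQ : ContinuousOn Q (Icc 0 Real.pi)) (l a b : ℝ) :
    ∃ y u : ℝ → ℝ, Sol Q l y u ∧ y 0 = a ∧ u 0 = b := by
  obtain ⟨M, hM0, hM⟩ := exists_abs_le hQ
  have hπ := Real.pi_pos.le
  set C : ℝ := M + 1 + |l| + M ^ 2 with hC
  have hC0 : 0 ≤ C := by positivity
  -- The Gronwall bound at time `π` for a field of linear growth `C`.
  set R : ℝ := ‖(a, b)‖ * Real.exp (C * Real.pi) with hR
  have hR0 : 0 ≤ R := by positivity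
  let c : ℝ → ℝ := fun s => max (-R) (min R s)
  have hc_le : ∀ s, |c s| ≤ R := fun s => by
    simp only [c, abs_le]
    exact ⟨le_max_left _ _, max_le (by linarith) (min_le_left _ _)⟩
  have hc_le' : ∀ s, |c s| ≤ |s| := fun s => by
    simp only [c]
    rcases abs_cases s with h | h <;>
      rcases le_total R s with h1 | h1 <;> rcases le_total (-R) s with h2 | h2 <;>
      simp [h1, h2, abs_le] <;> grind
  have hc_lip : ∀ s t, |c s - c t| ≤ |s - t| := fun s t => by
    simp only [c]
    refine (abs_max_sub_max_le_max _ _ _ _).trans ?_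
    rw [sub_self, abs_zero]
    refine max_le (abs_nonneg _) ?_
    refine (abs_min_sub_min_le_max _ _ _ _).trans ?_
    simp
  have hc_eq : ∀ s, |s| ≤ R → c s = s := fun s hs => by
    rw [abs_le] at hs
    simp [c, hs.1, hs.2]
  let f : ℝ → ℝ × ℝ → ℝ × ℝ := fun t p => field (Q t) l (c p.1, c p.2)
  have hpl : IsPicardLindelof f (tmin := 0) (tmax := Real.pi) ⟨0, le_rfl, hπ⟩ (a, b)
      (⟨C * R * Real.pi, by positivity⟩) 0 ⟨C * R, by positivity⟩ ⟨C, hC0⟩ := by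
    refine ⟨fun t ht => ?_, fun p _ => ?_, fun t ht p _ => ?_, ?_⟩
    · refine LipschitzWith.lipschitzOnWith (LipschitzWith.of_dist_le_mul fun p p' => ?_)
      rw [dist_eq_norm, dist_eq_norm, field_sub]
      refine (norm_field_le (hM t ht) _).trans ?_
      refine mul_le_mul_of_nonneg_left ?_ hC0
      exact max_le_max (hc_lip _ _) (hc_lip _ _)
    · simp only [f, field]
      fun_prop
    · refine (norm_field_le (hM t ht) _).trans ?_
      exact mul_le_mul_of_nonneg_left (max_le (hc_le _) (hc_le _)) hC0
    · simp only [sub_zero, sub_self, max_eq_left hπ, NNReal.coe_zero]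
      exact le_rfl
  obtain ⟨α, hα0, hα⟩ := hpl.exists_eq_forall_mem_Icc_hasDerivWithinAt₀
  have hbound : ∀ x ∈ Icc 0 Real.pi, ‖α x‖ ≤ R := by
    intro x hx
    have := norm_le_gronwallBound_of_norm_deriv_right_le (K := C) (ε := 0) (δ := ‖(a, b)‖)
      (fun x hx => (hα x hx).continuousWithinAt)
      (fun x hx => hasDerivWithinAt_Ici_of_Icc hx (hα x (Ico_subset_Icc_self hx)))
      (by rw [show α 0 = (a, b) from hα0]) (fun x hx => by
        rw [add_zero]
        refine (norm_field_le (hM x (Ico_subset_Icc_self hx)) _).trans ?_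
        exact mul_le_mul_of_nonneg_left (max_le_max (hc_le' _) (hc_le' _)) hC0) x hx
    refine this.trans ?_
    rw [gronwallBound_ε0, hR]
    gcongr
    linarith [hx.2]
  have hα' : ∀ x ∈ Icc 0 Real.pi,
      HasDerivWithinAt α (field (Q x) l (α x)) (Icc 0 Real.pi) x := by
    intro x hx
    have := hα x hx
    simp only [f] at this
    rwa [hc_eq _ ((norm_fst_le _).trans (hbound x hx)),
      hc_eq _ ((norm_snd_le _).trans (hbound x hx))] at this
  refine ⟨fun x => (α x).1, fun x => (α x).2, ⟨fun x hx => ?_, fun x hx => ?_⟩, ?_, ?_⟩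
  · exact (hα' x hx).fst
  · exact (hα' x hx).snd
  · exact congrArg Prod.fst hα0
  · exact congrArg Prod.snd hα0

/-- Solutions with the same initial data depend continuously on the spectral parameter,
uniformly on `[0, π]`. -/
theorem Sol.exists_close {Q : ℝ → ℝ} (hQ : ContinuousOn Q (Icc 0 Real.pi)) {l₀ : ℝ}
    {y₀ u₀ : ℝ → ℝ} (h₀ : Sol Q l₀ y₀ u₀) {ε : ℝ} (hε : 0 < ε) :
    ∃ r > 0, ∀ l y u, Sol Q l y u → y 0 = y₀ 0 → u 0 = u₀ 0 → |l - l₀| < r →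
      ∀ x ∈ Icc 0 Real.pi, |y x - y₀ x| < ε ∧ |u x - u₀ x| < ε := by
  obtain ⟨M, hM0, hM⟩ := exists_abs_le hQ
  obtain ⟨B, hB0, hB⟩ := exists_abs_le h₀.continuousOn_fst
  -- `|l₀| + 1` bounds `|l|` once `|l - l₀| < 1`, so a single Gronwall constant serves all nearby
  -- parameters.
  set C : ℝ := M + 1 + (|l₀| + 1) + M ^ 2 with hC
  have hC0 : 0 ≤ C := by positivity
  have hlim : Tendsto (fun s => gronwallBound 0 C (s * B) Real.pi) (𝓝 0) (𝓝 0) := by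
    have : Continuous fun s => gronwallBound 0 C (s * B) Real.pi :=
      (gronwallBound_continuous_ε 0 C Real.pi).comp (continuous_id.mul continuous_const)
    simpa [gronwallBound_ε0_δ0] using this.tendsto 0
  obtain ⟨r, hr, hr'⟩ := Metric.eventually_nhds_iff.1 (hlim.eventually_lt_const hε)
  refine ⟨min r 1, by positivity, fun l y u h hy hu hl x hx => ?_⟩
  have hl1 : |l - l₀| < 1 := hl.trans_le (min_le_right _ _)
  have hlr : |l - l₀| < r := hl.trans_le (min_le_left _ _)
  have hlC : |l| ≤ |l₀| + 1 := by
    have := abs_sub_abs_le_abs_sub l l₀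
    linarith
  -- The difference solves the system for `l` with zero initial data and the small forcing term `-(l
  -- - l₀) y₀`.
  have hd : ∀ t ∈ Icc 0 Real.pi, HasDerivWithinAt (fun t => (y t - y₀ t, u t - u₀ t))
      (field (Q t) l (y t - y₀ t, u t - u₀ t) + (0, -(l - l₀) * y₀ t)) (Icc 0 Real.pi) t := by
    intro t ht
    refine (((h.deriv_fst t ht).sub (h₀.deriv_fst t ht)).prodMk
      ((h.deriv_snd t ht).sub (h₀.deriv_snd t ht))).congr_deriv ?_
    ext <;> simp [field] <;> ring
  have := norm_le_gronwallBound_of_norm_deriv_right_le (K := C) (ε := |l - l₀| * B) (δ := 0)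
      (fun x hx => (hd x hx).continuousWithinAt)
      (fun x hx => hasDerivWithinAt_Ici_of_Icc hx (hd x (Ico_subset_Icc_self hx)))
      (by simp [hy, hu]) (fun x hx => by
        have hx' := Ico_subset_Icc_self hx
        refine (norm_add_le _ _).trans (add_le_add ?_ ?_)
        · refine (norm_field_le (hM x hx') _).trans ?_
          rw [hC]
          gcongr
        · refine max_le (by simpa using by positivity) ?_
          simp only [norm_mul, norm_neg, Real.norm_eq_abs]
          gcongr
          exact hB x hx') x hx
  have h2 := gronwallBound_mono (δ := 0) (K := C) (ε := |l - l₀| * B) le_rfl (by positivity) hC0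
    (show x - 0 ≤ Real.pi by linarith [hx.2])
  have h3 : gronwallBound 0 C (|l - l₀| * B) Real.pi < ε := hr' (by simpa using hlr)
  have h4 := (this.trans h2).trans_lt h3
  exact ⟨(norm_fst_le _).trans_lt h4, (norm_snd_le _).trans_lt h4⟩

/-- A solution that vanishes at a point together with its quasi-derivative is trivial. -/
theorem Sol.eq_zero {Q : ℝ → ℝ} (hQ : ContinuousOn Q (Icc 0 Real.pi)) {l : ℝ} {y u : ℝ → ℝ}
    (h : Sol Q l y u) {c : ℝ} (hc : c ∈ Icc 0 Real.pi) (hy : y c = 0) (hu : u c = 0) :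
    ∀ x ∈ Icc 0 Real.pi, y x = 0 ∧ u x = 0 := by
  obtain ⟨M, hM0, hM⟩ := exists_abs_le hQ
  -- With this `K`, `|(y² + u²)'| ≤ K (y² + u²)`. Hence `exp (K x) (y² + u²)` increases, which
  -- settles points left of `c`, and `exp (-K x) (y² + u²)` decreases, which settles points to the
  -- right.
  set K : ℝ := 4 * (M + 1 + |l| + M ^ 2) with hK
  have hd : ∀ s : ℝ, ∀ x ∈ Icc 0 Real.pi, HasDerivWithinAt
      (fun x => Real.exp (s * x) * (y x ^ 2 + u x ^ 2))
      (Real.exp (s * x) * (s * (y x ^ 2 + u x ^ 2) +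
        2 * (y x * (Q x * y x + u x) + u x * (-(l + Q x ^ 2) * y x - Q x * u x))))
      (Icc 0 Real.pi) x := by
    intro s x hx
    have he : HasDerivAt (fun x => Real.exp (s * x)) (Real.exp (s * x) * (s * 1)) x :=
      ((hasDerivAt_id x).const_mul s).exp
    refine (he.hasDerivWithinAt.mul (((h.deriv_fst x hx).pow 2).add
      ((h.deriv_snd x hx).pow 2))).congr_deriv ?_
    simp; ring
  have hb : ∀ x ∈ Icc 0 Real.pi,
      |2 * (y x * (Q x * y x + u x) + u x * (-(l + Q x ^ 2) * y x - Q x * u x))| ≤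
        K * (y x ^ 2 + u x ^ 2) := by
    intro x hx
    have h1 := norm_field_le (l := l) (hM x hx) (y x, u x)
    have h2 : |Q x * y x + u x| ≤ _ := (norm_fst_le _).trans h1
    have h3 : |(-(l + Q x ^ 2) * y x - Q x * u x)| ≤ _ := (norm_snd_le _).trans h1
    have h4 : |y x| ≤ ‖(y x, u x)‖ := norm_fst_le (y x, u x)
    have h5 : |u x| ≤ ‖(y x, u x)‖ := norm_snd_le (y x, u x)
    have h6 : ‖(y x, u x)‖ ^ 2 ≤ y x ^ 2 + u x ^ 2 := by
      rcases max_choice ‖y x‖ ‖u x‖ with h | h <;> rw [Prod.norm_mk, h] <;>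
        simp only [Real.norm_eq_abs, sq_abs] <;> nlinarith [sq_nonneg (y x), sq_nonneg (u x)]
    set N := ‖(y x, u x)‖
    have hN : 0 ≤ N := norm_nonneg _
    rw [abs_mul, abs_two]
    calc 2 * |y x * (Q x * y x + u x) + u x * (-(l + Q x ^ 2) * y x - Q x * u x)|
        ≤ 2 * (|y x| * |Q x * y x + u x| + |u x| * |(-(l + Q x ^ 2) * y x - Q x * u x)|) := by
          rw [← abs_mul, ← abs_mul]; gcongr; exact abs_add_le _ _
      _ ≤ 2 * (N * ((M + 1 + |l| + M ^ 2) * N) + N * ((M + 1 + |l| + M ^ 2) * N)) := by gcongr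
      _ = K * N ^ 2 := by rw [hK]; ring
      _ ≤ _ := by gcongr
  have key : ∀ x ∈ Icc 0 Real.pi, y x ^ 2 + u x ^ 2 ≤ 0 := by
    intro x hx
    have hsub : interior (Icc 0 Real.pi) ⊆ Icc 0 Real.pi := interior_subset
    rcases le_total x c with hxc | hxc
    · have hmono := monotoneOn_of_hasDerivWithinAt_nonneg (convex_Icc 0 Real.pi)
        (fun x hx => (hd K x hx).continuousWithinAt)
        (fun x hx => (hd K x (hsub hx)).mono hsub) (fun x hx => by
          have := (abs_le.1 (hb x (hsub hx))).1
          exact mul_nonneg (Real.exp_pos _).le (by linarith)) hx hc hxc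
      simp only [hy, hu] at hmono
      have := Real.exp_pos (K * x)
      by_contra hcon
      push Not at hcon
      nlinarith [mul_pos this hcon]
    · have hanti := antitoneOn_of_hasDerivWithinAt_nonpos (convex_Icc 0 Real.pi)
        (fun x hx => (hd (-K) x hx).continuousWithinAt)
        (fun x hx => (hd (-K) x (hsub hx)).mono hsub) (fun x hx => by
          have := (abs_le.1 (hb x (hsub hx))).2
          exact mul_nonpos_of_nonneg_of_nonpos (Real.exp_pos _).le (by linarith)) hc hx hxc
      simp only [hy, hu] at hanti
      have := Real.exp_pos (-K * x)
      by_contra hcon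
      push Not at hcon
      nlinarith [mul_pos this hcon]
  intro x hx
  have := key x hx
  constructor <;> nlinarith [sq_nonneg (y x), sq_nonneg (u x)]

/-! ### Shooting: an eigenvalue with a positive eigenfunction. -/

/-- The left-hand side of the boundary condition at `π`, in terms of the quasi-derivative. -/
noncomputable def rightForm (Q : ℝ → ℝ) (δ : ℝ) (y u : ℝ → ℝ) : ℝ :=
  y Real.pi * Real.cos δ + (Q Real.pi * y Real.pi + u Real.pi) * Real.sin δ

theorem Sol.not_both_zero {Q : ℝ → ℝ} (hQ : ContinuousOn Q (Icc 0 Real.pi)) {l γ : ℝ}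
    {y u : ℝ → ℝ} (h : Sol Q l y u) (hy : y 0 = Real.sin γ) (hu : u 0 = -Real.cos γ)
    {c : ℝ} (hc : c ∈ Icc 0 Real.pi) (hyc : y c = 0) : u c ≠ 0 := by
  intro huc
  obtain ⟨h1, h2⟩ := h.eq_zero hQ hc hyc huc 0 ⟨le_rfl, Real.pi_pos.le⟩
  have := Real.sin_sq_add_cos_sq γ
  rw [← hy, h1, show Real.cos γ = 0 by linarith] at this
  norm_num at this

/-- Solutions starting from the left boundary condition are positive to the right of `0`, uniformly
for nearby spectral parameters. -/
theorem Sol.exists_pos_near_zero {Q : ℝ → ℝ} (hQ : ContinuousOn Q (Icc 0 Real.pi)) {l₀ γ : ℝ}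
    (hγ : γ ∈ Ioc 0 Real.pi) {y₀ u₀ : ℝ → ℝ} (h₀ : Sol Q l₀ y₀ u₀) (hy₀ : y₀ 0 = Real.sin γ)
    (hu₀ : u₀ 0 = -Real.cos γ) :
    ∃ η ∈ Ioc 0 Real.pi, ∃ r > 0, ∀ l y u, Sol Q l y u → y 0 = Real.sin γ → u 0 = -Real.cos γ →
      |l - l₀| < r → ∀ x ∈ Ioc 0 η, 0 < y x := by
  have hπ := Real.pi_pos
  have h0 : (0 : ℝ) ∈ Icc 0 Real.pi := ⟨le_rfl, hπ.le⟩
  have extract : ∀ {p : ℝ → Prop}, (∀ᶠ x in 𝓝[Icc 0 Real.pi] 0, p x) →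
      ∃ η ∈ Ioc 0 Real.pi, ∀ x ∈ Icc 0 η, p x := by
    intro p hp
    rw [nhdsWithin_Icc_eq_nhdsGE hπ] at hp
    obtain ⟨η, hη, hη'⟩ := (mem_nhdsGE_iff_exists_Icc_subset).1 hp
    refine ⟨min η Real.pi, ⟨lt_min hη hπ, min_le_right _ _⟩, fun x hx => hη' ⟨hx.1, ?_⟩⟩
    exact hx.2.trans (min_le_left _ _)
  rcases hγ.2.lt_or_eq with hlt | rfl
  · have hs : 0 < Real.sin γ := Real.sin_pos_of_pos_of_lt_pi hγ.1 hlt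
    obtain ⟨η, hη, hη'⟩ := extract ((h₀.continuousOn_fst 0 h0).eventually_const_lt
      (show Real.sin γ / 2 < y₀ 0 by linarith))
    obtain ⟨r, hr, hr'⟩ := h₀.exists_close hQ (half_pos hs)
    refine ⟨η, hη, r, hr, fun l y u h hy hu hl x hx => ?_⟩
    have h1 := hη' x ⟨hx.1.le, hx.2⟩
    have h2 := (abs_lt.1 (hr' l y u h (by rw [hy, hy₀]) (by rw [hu, hu₀]) hl x
      ⟨hx.1.le, hx.2.trans hη.2⟩).1).1
    linarith
  -- Dirichlet case `γ = π`: here `y 0 = 0`, so closeness of values is not enough. Instead `y' = Q y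
  -- + u` is kept positive near `0`, starting from `y₀' 0 = 1`.
  · simp only [Real.sin_pi, Real.cos_pi, neg_neg] at *
    obtain ⟨M, hM0, hM⟩ := exists_abs_le hQ
    have hcont : ContinuousOn (fun x => Q x * y₀ x + u₀ x) (Icc 0 Real.pi) :=
      (hQ.mul h₀.continuousOn_fst).add h₀.continuousOn_snd
    obtain ⟨η, hη, hη'⟩ := extract ((hcont 0 h0).eventually_const_lt
      (show (1 / 2 : ℝ) < _ by simp only [hy₀, hu₀]; norm_num))
    -- With this tolerance `Q (y - y₀) + (u - u₀)` exceeds `-1/2`, while `Q y₀ + u₀ > 1/2`.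
    obtain ⟨r, hr, hr'⟩ := h₀.exists_close hQ (show 0 < 1 / (2 * (M + 1)) by positivity)
    refine ⟨η, hη, r, hr, fun l y u h hy hu hl x hx => ?_⟩
    have hsub : Icc 0 η ⊆ Icc 0 Real.pi := Icc_subset_Icc_right hη.2
    have hmono := strictMonoOn_of_hasDerivWithinAt_pos (convex_Icc 0 η)
      (h.continuousOn_fst.mono hsub)
      (fun x hx => (h.deriv_fst x (hsub (interior_subset hx))).mono
        (interior_subset.trans hsub)) (fun x hx => by
          have hx' := interior_subset hx
          have h1 := hη' x hx'
          obtain ⟨h2, h3⟩ := hr' l y u h (by rw [hy, hy₀]) (by rw [hu, hu₀]) hl x (hsub hx')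
          have h4 : |Q x * (y x - y₀ x)| ≤ M * (1 / (2 * (M + 1))) := by
            rw [abs_mul]
            exact mul_le_mul (hM x (hsub hx')) h2.le (abs_nonneg _) hM0
          have h5 : M * (1 / (2 * (M + 1))) + 1 / (2 * (M + 1)) = 1 / 2 := by
            field_simp
          have h6 := (abs_le.1 h4).1
          have h7 := (abs_lt.1 h3).1
          linarith)
    have := hmono ⟨le_rfl, hη.1.le⟩ ⟨hx.1.le, hx.2⟩ hx.1
    rwa [hy] at this

theorem nonpos_deriv_of_nonneg_left {f : ℝ → ℝ} {f' c : ℝ} (hc : c ∈ Ioc 0 Real.pi)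
    (hf : HasDerivWithinAt f f' (Icc 0 Real.pi) c) (hfc : f c = 0)
    (hpos : ∀ x ∈ Ioo 0 c, 0 ≤ f x) : f' ≤ 0 := by
  have h1 : HasDerivWithinAt f f' (Ioo 0 c) c :=
    hf.mono fun x hx => ⟨hx.1.le, hx.2.le.trans hc.2⟩
  have h2 := hasDerivWithinAt_iff_tendsto_slope.1 h1
  rw [sdiff_singleton_eq_self (by simp)] at h2
  have : (𝓝[Ioo 0 c] c).NeBot := by
    rw [nhdsWithin_Ioo_eq_nhdsLT hc.1]; infer_instance
  refine le_of_tendsto h2 ?_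
  filter_upwards [self_mem_nhdsWithin] with x hx
  rw [slope_def_field, hfc, sub_zero]
  exact div_nonpos_of_nonneg_of_nonpos (hpos x hx) (sub_nonpos.2 hx.2.le)

/-- For some spectral parameter the solution from the left boundary condition is positive and lies
on the positive side of the right one. -/
theorem exists_lower {Q : ℝ → ℝ} (hQ : ContinuousOn Q (Icc 0 Real.pi)) {γ δ : ℝ}
    (hγ : γ ∈ Ioc 0 Real.pi) (hδ : δ ∈ Ico 0 Real.pi) :
    ∃ l, ∀ y u, Sol Q l y u → y 0 = Real.sin γ → u 0 = -Real.cos γ →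
      (∀ x ∈ Ioc 0 Real.pi, 0 < y x) ∧ 0 < rightForm Q δ y u := by
  have hπ := Real.pi_pos
  have hsγ : 0 ≤ Real.sin γ := Real.sin_nonneg_of_nonneg_of_le_pi hγ.1.le hγ.2
  have hsδ : 0 ≤ Real.sin δ := Real.sin_nonneg_of_nonneg_of_le_pi hδ.1 hδ.2.le
  -- Work with `v = u - (α + s x) y`, where `α + s x` runs linearly from `α` at `0` to `β` at `π`.
  -- The choice of `α` makes `v 0 > 0`; that of `β` makes the form at `π` a positive multiple of `y
  -- π` plus `v π * sin δ`.
  obtain ⟨α, hα⟩ : ∃ α, 0 < -Real.cos γ - α * Real.sin γ := by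
    rcases hγ.2.lt_or_eq with hlt | rfl
    · have hs : 0 < Real.sin γ := Real.sin_pos_of_pos_of_lt_pi hγ.1 hlt
      refine ⟨(-Real.cos γ - 1) / Real.sin γ, ?_⟩
      rw [div_mul_cancel₀ _ hs.ne']
      linarith
    · exact ⟨0, by simp⟩
  obtain ⟨β, hβ⟩ : ∃ β, 0 < Real.cos δ + (Q Real.pi + β) * Real.sin δ := by
    rcases hδ.1.lt_or_eq with hlt | rfl
    · have hs : 0 < Real.sin δ := Real.sin_pos_of_pos_of_lt_pi hlt hδ.2
      refine ⟨(1 - Real.cos δ) / Real.sin δ - Q Real.pi, ?_⟩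
      rw [add_sub_cancel, div_mul_cancel₀ _ hs.ne']
      linarith
    · exact ⟨0, by simp⟩
  set s : ℝ := (β - α) / Real.pi with hs
  obtain ⟨M, hM0, hM⟩ := exists_abs_le (Q := fun x => Q x + (α + s * x))
    (hQ.add (by fun_prop))
  -- This makes `(y v)' ≥ v² + y² > 0`. So `y v > 0` on `(0, π]`, `v` never vanishes, and `y` has
  -- the sign of `v`.
  refine ⟨-(s + M ^ 2 + 1), fun y u h hy hu => ?_⟩
  set l : ℝ := -(s + M ^ 2 + 1) with hl
  set v : ℝ → ℝ := fun x => u x - (α + s * x) * y x with hv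
  have hcv : ContinuousOn v (Icc 0 Real.pi) :=
    h.continuousOn_snd.sub (ContinuousOn.mul (by fun_prop) h.continuousOn_fst)
  have hd : ∀ x ∈ Icc 0 Real.pi, HasDerivWithinAt (fun x => y x * v x)
      (v x ^ 2 - (l + s + (Q x + (α + s * x)) ^ 2) * y x ^ 2) (Icc 0 Real.pi) x := by
    intro x hx
    have ha : HasDerivWithinAt (fun x => α + s * x) (s * 1) (Icc 0 Real.pi) x :=
      (((hasDerivAt_id x).const_mul s).const_add α).hasDerivWithinAt
    refine ((h.deriv_fst x hx).mul ((h.deriv_snd x hx).sub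
      (ha.mul (h.deriv_fst x hx)))).congr_deriv ?_
    simp only [hv, Pi.sub_apply, Pi.mul_apply]
    ring
  have hmono := strictMonoOn_of_hasDerivWithinAt_pos (convex_Icc 0 Real.pi)
    (fun x hx => (hd x hx).continuousWithinAt)
    (fun x hx => (hd x (interior_subset hx)).mono interior_subset) (fun x hx => by
      have hx' := interior_subset hx
      have h1 : (Q x + (α + s * x)) ^ 2 ≤ M ^ 2 := sq_le_sq' (abs_le.1 (hM x hx')).1
        (abs_le.1 (hM x hx')).2
      have h2 : y x ^ 2 ≤ -(l + s + (Q x + (α + s * x)) ^ 2) * y x ^ 2 :=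
        le_mul_of_one_le_left (sq_nonneg _) (by rw [hl]; linarith)
      have h3 : 0 < v x ^ 2 + y x ^ 2 := by
        by_cases hyx : y x = 0
        · have := h.not_both_zero hQ hy hu hx' hyx
          simp only [hv, hyx, mul_zero, sub_zero]
          positivity
        · positivity
      linarith)
  have h0 : (0 : ℝ) ∈ Icc 0 Real.pi := ⟨le_rfl, hπ.le⟩
  have hv0 : 0 < v 0 := by simp only [hv, hy, hu]; linarith
  have hyv : ∀ x ∈ Ioc 0 Real.pi, 0 < y x * v x := fun x hx => by
    have := hmono h0 ⟨hx.1.le, hx.2⟩ hx.1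
    refine lt_of_le_of_lt ?_ this
    simp only [hy]
    positivity
  have hvpos : ∀ x ∈ Icc 0 Real.pi, 0 < v x := by
    intro x hx
    by_contra hcon
    push Not at hcon
    obtain ⟨c, hc, hvc⟩ := intermediate_value_Icc' hx.1
      (hcv.mono (Icc_subset_Icc_right hx.2)) ⟨hcon, hv0.le⟩
    rcases hc.1.lt_or_eq with hc0 | rfl
    · have := hyv c ⟨hc0, hc.2.trans hx.2⟩
      simp [hvc] at this
    · exact hv0.ne' hvc
  have hypos : ∀ x ∈ Ioc 0 Real.pi, 0 < y x := fun x hx =>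
    pos_of_mul_pos_left (hyv x hx) (hvpos x ⟨hx.1.le, hx.2⟩).le
  refine ⟨hypos, ?_⟩
  have h1 := hypos Real.pi ⟨hπ, le_rfl⟩
  have h2 := hvpos Real.pi ⟨hπ.le, le_rfl⟩
  have h3 : s * Real.pi = β - α := div_mul_cancel₀ _ hπ.ne'
  have h4 : rightForm Q δ y u =
      y Real.pi * (Real.cos δ + (Q Real.pi + β) * Real.sin δ) + v Real.pi * Real.sin δ := by
    simp only [rightForm, hv, h3]
    ring
  rw [h4]
  positivity

/-- The spectral parameters of positive solutions are bounded above. -/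
theorem exists_upper {Q : ℝ → ℝ} (hQ : ContinuousOn Q (Icc 0 Real.pi)) :
    ∃ B, ∀ l y u, Sol Q l y u → (∀ x ∈ Ioo 0 Real.pi, 0 < y x) → l ≤ B := by
  obtain ⟨M, hM0, hM⟩ := exists_abs_le hQ
  -- The ratio `t = u / y` satisfies the Riccati equation `t' = -l - (Q + t)²`. Since `(Q + t)² ≥
  -- t²/2 - Q²`, any `l > 32 + M²` makes `arctan (t / 8) + 4 x` nonincreasing on `[1, 2]`. Then
  -- `arctan` would drop by at least `4`, more than its range `π` allows.
  refine ⟨32 + M ^ 2, fun l y u h hpos => ?_⟩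
  by_contra! hl
  have h3 := Real.pi_gt_three
  have hsub : Icc (1 : ℝ) 2 ⊆ Icc 0 Real.pi := Icc_subset_Icc (by norm_num) (by linarith)
  have hy : ∀ x ∈ Icc (1 : ℝ) 2, 0 < y x := fun x hx =>
    hpos x ⟨by linarith [hx.1], by linarith [hx.2]⟩
  have hd : ∀ x ∈ Icc (1 : ℝ) 2, HasDerivWithinAt
      (fun x => Real.arctan (u x / y x / 8) + 4 * x)
      (1 / (1 + (u x / y x / 8) ^ 2) * ((-l - (Q x + u x / y x) ^ 2) / 8) + 4)
      (Icc 1 2) x := by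
    intro x hx
    have hne := (hy x hx).ne'
    refine HasDerivWithinAt.add ?_ (((hasDerivAt_id x).const_mul 4).congr_deriv
      (by norm_num)).hasDerivWithinAt
    refine (((((h.deriv_snd x (hsub hx)).mono hsub).div ((h.deriv_fst x (hsub hx)).mono hsub)
      hne).div_const 8).arctan).congr_deriv ?_
    congr 2
    field_simp
    ring
  have hanti := antitoneOn_of_hasDerivWithinAt_nonpos (convex_Icc (1 : ℝ) 2)
    (fun x hx => (hd x hx).continuousWithinAt)
    (fun x hx => (hd x (interior_subset hx)).mono interior_subset) (fun x hx => by
      have hx' := interior_subset hx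
      have hQx : Q x ^ 2 ≤ M ^ 2 := sq_le_sq' (abs_le.1 (hM x (hsub hx'))).1
        (abs_le.1 (hM x (hsub hx'))).2
      generalize u x / y x = t
      have : 1 / (1 + (t / 8) ^ 2) * ((-l - (Q x + t) ^ 2) / 8) + 4 =
        ((-l - (Q x + t) ^ 2) / 8 + 4 * (1 + (t / 8) ^ 2)) / (1 + (t / 8) ^ 2) := by
        field_simp
      rw [this]
      refine div_nonpos_of_nonpos_of_nonneg ?_ (by positivity)
      nlinarith [sq_nonneg (2 * Q x + t)])
  have := hanti (left_mem_Icc.2 one_le_two) (right_mem_Icc.2 one_le_two) one_le_two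
  have h4 := Real.neg_pi_div_two_lt_arctan (u 2 / y 2 / 8)
  have h5 := Real.arctan_lt_pi_div_two (u 1 / y 1 / 8)
  have h6 := Real.pi_lt_four
  simp only at this
  linarith

theorem Sol.exists_rightForm_close {Q : ℝ → ℝ} (hQ : ContinuousOn Q (Icc 0 Real.pi)) {l₀ : ℝ}
    {y₀ u₀ : ℝ → ℝ} (h₀ : Sol Q l₀ y₀ u₀) (δ : ℝ) {ε : ℝ} (hε : 0 < ε) :
    ∃ r > 0, ∀ l y u, Sol Q l y u → y 0 = y₀ 0 → u 0 = u₀ 0 → |l - l₀| < r →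
      |rightForm Q δ y u - rightForm Q δ y₀ u₀| < ε := by
  have hπ : Real.pi ∈ Icc 0 Real.pi := ⟨Real.pi_pos.le, le_rfl⟩
  obtain ⟨r, hr, hr'⟩ := h₀.exists_close hQ (show 0 < ε / (|Q Real.pi| + 2) by positivity)
  refine ⟨r, hr, fun l y u h hy hu hl => ?_⟩
  obtain ⟨h1, h2⟩ := hr' l y u h hy hu hl _ hπ
  set a := y Real.pi - y₀ Real.pi with ha
  set b := u Real.pi - u₀ Real.pi with hb
  have h3 : rightForm Q δ y u - rightForm Q δ y₀ u₀ =
      a * Real.cos δ + (Q Real.pi * a + b) * Real.sin δ := by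
    simp only [rightForm, ha, hb]
    ring
  rw [h3]
  calc |a * Real.cos δ + (Q Real.pi * a + b) * Real.sin δ|
      ≤ |a| * |Real.cos δ| + (|Q Real.pi| * |a| + |b|) * |Real.sin δ| := by
        refine (abs_add_le _ _).trans ?_
        rw [abs_mul, abs_mul _ (Real.sin δ), ← abs_mul (Q Real.pi)]
        gcongr
        exact abs_add_le _ _
    _ ≤ |a| * 1 + (|Q Real.pi| * |a| + |b|) * 1 := by
        gcongr
        exacts [Real.abs_cos_le_one δ, Real.abs_sin_le_one δ]
    _ < ε / (|Q Real.pi| + 2) * 1 + (|Q Real.pi| * (ε / (|Q Real.pi| + 2)) +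
        ε / (|Q Real.pi| + 2)) * 1 := by
        have := mul_le_mul_of_nonneg_left h1.le (abs_nonneg (Q Real.pi))
        linarith
    _ = ε := by field_simp; ring

/-- There is a spectral parameter for which the solution from the left boundary condition is
positive and satisfies the right one. -/
theorem exists_pos_eigenpair {Q : ℝ → ℝ} (hQ : ContinuousOn Q (Icc 0 Real.pi)) {γ δ : ℝ}
    (hγ : γ ∈ Ioc 0 Real.pi) (hδ : δ ∈ Ico 0 Real.pi) :
    ∃ m y u, Sol Q m y u ∧ y 0 = Real.sin γ ∧ u 0 = -Real.cos γ ∧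
      (∀ x ∈ Ioo 0 Real.pi, 0 < y x) ∧ rightForm Q δ y u = 0 := by
  have hπ := Real.pi_pos
  have hsδ : 0 ≤ Real.sin δ := Real.sin_nonneg_of_nonneg_of_le_pi hδ.1 hδ.2.le
  choose Y U hsol hY hU using fun l => exists_sol hQ l (Real.sin γ) (-Real.cos γ)
  set S : Set ℝ := {l | (∀ x ∈ Ioc 0 Real.pi, 0 < Y l x) ∧ 0 < rightForm Q δ (Y l) (U l)} with hS
  have hne : S.Nonempty := by
    obtain ⟨l, hl⟩ := exists_lower hQ hγ hδ
    exact ⟨l, hl _ _ (hsol l) (hY l) (hU l)⟩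
  have hbdd : BddAbove S := by
    obtain ⟨B, hB⟩ := exists_upper hQ
    exact ⟨B, fun l hl => hB l _ _ (hsol l) fun x hx => hl.1 x ⟨hx.1, hx.2.le⟩⟩
  set m := sSup S with hm
  have happrox : ∀ r > 0, ∃ l ∈ S, |l - m| < r := by
    intro r hr
    obtain ⟨l, hl, hlt⟩ := exists_lt_of_lt_csSup hne (show m - r < sSup S by linarith)
    exact ⟨l, hl, abs_lt.2 ⟨by linarith, by linarith [le_csSup hbdd hl]⟩⟩
  have hnonneg : ∀ x ∈ Ioc 0 Real.pi, 0 ≤ Y m x := by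
    intro x hx
    by_contra! hcon
    obtain ⟨r, hr, hr'⟩ := (hsol m).exists_close hQ (neg_pos.2 hcon)
    obtain ⟨l, hl, hlr⟩ := happrox r hr
    have h1 := (abs_lt.1 (hr' l _ _ (hsol l) (by rw [hY, hY]) (by rw [hU, hU]) hlr x
      ⟨hx.1.le, hx.2⟩).1).2
    linarith [hl.1 x hx]
  have hF : 0 ≤ rightForm Q δ (Y m) (U m) := by
    by_contra! hcon
    obtain ⟨r, hr, hr'⟩ := (hsol m).exists_rightForm_close hQ δ (neg_pos.2 hcon)
    obtain ⟨l, hl, hlr⟩ := happrox r hr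
    have h1 := (abs_lt.1 (hr' l _ _ (hsol l) (by rw [hY, hY]) (by rw [hU, hU]) hlr)).2
    linarith [hl.2]
  -- An interior zero of a nonnegative solution is a minimum, so `y` and `u` vanish there together,
  -- against uniqueness.
  have hpos : ∀ x ∈ Ioo 0 Real.pi, 0 < Y m x := by
    intro x hx
    refine (hnonneg x ⟨hx.1, hx.2.le⟩).lt_of_ne' fun hzero => ?_
    have hx' := Ioo_subset_Icc_self hx
    have hder := ((hsol m).deriv_fst x hx').hasDerivAt (Icc_mem_nhds hx.1 hx.2)
    have hmin : IsLocalMin (Y m) x := by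
      filter_upwards [Ioo_mem_nhds hx.1 hx.2] with t ht
      rw [hzero]
      exact hnonneg t ⟨ht.1, ht.2.le⟩
    have h1 := hmin.hasDerivAt_eq_zero hder
    rw [hzero, mul_zero, zero_add] at h1
    exact (hsol m).not_both_zero hQ (hY m) (hU m) hx' hzero h1
  refine ⟨m, Y m, U m, hsol m, hY m, hU m, hpos, ?_⟩
  -- If the form at `π` were positive, `m` could be increased within `S`: positivity persists near
  -- `0` by `exists_pos_near_zero`, and on `[η, π]` because `Y m` has a positive minimum there.
  by_contra hFne
  have hFpos : 0 < rightForm Q δ (Y m) (U m) := lt_of_le_of_ne hF (Ne.symm hFne)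
  have hposπ : 0 < Y m Real.pi := by
    refine (hnonneg _ ⟨hπ, le_rfl⟩).lt_of_ne' fun hzero => ?_
    have h1 := nonpos_deriv_of_nonneg_left ⟨hπ, le_rfl⟩
      ((hsol m).deriv_fst _ ⟨hπ.le, le_rfl⟩) hzero fun x hx => (hpos x hx).le
    rw [rightForm, hzero, zero_mul, zero_add] at hFpos
    rw [hzero] at h1
    exact hFpos.not_ge (mul_nonpos_of_nonpos_of_nonneg h1 hsδ)
  obtain ⟨η, hη, r₁, hr₁, hnear⟩ := (hsol m).exists_pos_near_zero hQ hγ (hY m) (hU m)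
  obtain ⟨x₀, hx₀, hmin⟩ := isCompact_Icc.exists_isMinOn (nonempty_Icc.2 hη.2)
    ((hsol m).continuousOn_fst.mono (Icc_subset_Icc_left hη.1.le))
  have hx₀pos : 0 < Y m x₀ := by
    rcases hx₀.2.lt_or_eq with hlt | rfl
    · exact hpos x₀ ⟨hη.1.trans_le hx₀.1, hlt⟩
    · exact hposπ
  obtain ⟨r₂, hr₂, hclose⟩ := (hsol m).exists_close hQ hx₀pos
  obtain ⟨r₃, hr₃, hFclose⟩ := (hsol m).exists_rightForm_close hQ δ hFpos
  set r := min r₁ (min r₂ r₃) with hr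
  have hr0 : 0 < r := by positivity
  have hl : |m + r / 2 - m| < r := by
    rw [add_sub_cancel_left, abs_of_pos (half_pos hr0)]
    exact half_lt_self hr0
  have hmem : m + r / 2 ∈ S := by
    refine ⟨fun x hx => ?_, ?_⟩
    · rcases le_total x η with hxη | hxη
      · exact hnear _ _ _ (hsol _) (hY _) (hU _) (hl.trans_le (min_le_left _ _)) x ⟨hx.1, hxη⟩
      · have h1 := (abs_lt.1 (hclose _ _ _ (hsol _) (by rw [hY, hY]) (by rw [hU, hU])
          (hl.trans_le ((min_le_right _ _).trans (min_le_left _ _))) x ⟨hx.1.le, hx.2⟩).1).1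
        have h2 : Y m x₀ ≤ Y m x := hmin ⟨hxη, hx.2⟩
        linarith
    · have h1 := (abs_lt.1 (hFclose _ _ _ (hsol _) (by rw [hY, hY]) (by rw [hU, hU])
          (hl.trans_le ((min_le_right _ _).trans (min_le_right _ _))))).1
      linarith
  linarith [le_csSup hbdd hmem]

/-! ### Wronskian comparison: minimality of the positive eigenpair. -/

/-- The derivative of the Wronskian of two solutions. -/
theorem Sol.hasDerivWithinAt_wronskian {Q : ℝ → ℝ} {m l : ℝ} {y u z w : ℝ → ℝ}
    (h : Sol Q m y u) (h' : Sol Q l z w) {x : ℝ} (hx : x ∈ Icc 0 Real.pi) :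
    HasDerivWithinAt (fun x => u x * z x - y x * w x) ((l - m) * (y x * z x))
      (Icc 0 Real.pi) x := by
  refine (((h.deriv_snd x hx).mul (h'.deriv_fst x hx)).sub
    ((h.deriv_fst x hx).mul (h'.deriv_snd x hx))).congr_deriv ?_
  ring

/-- Two vectors orthogonal to the same unit vector are parallel; this makes Wronskians vanish at an
endpoint where both functions satisfy the boundary condition. -/
theorem mul_eq_mul_of_cos_sin {a b c d γ : ℝ} (h1 : a * Real.cos γ + b * Real.sin γ = 0)
    (h2 : c * Real.cos γ + d * Real.sin γ = 0) : b * c = a * d := by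
  have := Real.sin_sq_add_cos_sq γ
  have h3 : (b * c - a * d) * (Real.sin γ ^ 2 + Real.cos γ ^ 2) = 0 := by
    linear_combination (c * Real.sin γ - d * Real.cos γ) * h1 +
      (b * Real.cos γ - a * Real.sin γ) * h2
  rw [this, mul_one] at h3
  linarith

/-- Sturm comparison. If `l < m`, the Wronskian `u z - y w` starts at `0` and strictly decreases as
long as `z > 0`. If `z > 0` throughout, this contradicts the condition at `π`. Otherwise, at the
first zero `c` of `z`, it equals `-y c * w c` with `w c = z' c ≤ 0`, hence is nonnegative. -/
theorem le_of_normalized_sol {Q : ℝ → ℝ} (hQ : ContinuousOn Q (Icc 0 Real.pi)) {γ δ m l : ℝ}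
    (hγ : γ ∈ Ioc 0 Real.pi) {y u z w : ℝ → ℝ} (h : Sol Q m y u)
    (hy : y 0 = Real.sin γ) (hu : u 0 = -Real.cos γ) (hpos : ∀ x ∈ Ioo 0 Real.pi, 0 < y x)
    (hF : rightForm Q δ y u = 0) (h' : Sol Q l z w) (hz : z 0 = Real.sin γ)
    (hw : w 0 = -Real.cos γ) (hF' : rightForm Q δ z w = 0) : m ≤ l := by
  by_contra! hlt
  have hπ := Real.pi_pos
  have hW : ∀ c ∈ Ioc 0 Real.pi, (∀ x ∈ Ioo 0 c, 0 < z x) →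
      u c * z c - y c * w c < 0 := by
    intro c hc hzc
    have hsub : Icc 0 c ⊆ Icc 0 Real.pi := Icc_subset_Icc_right hc.2
    have hanti := strictAntiOn_of_hasDerivWithinAt_neg (convex_Icc 0 c)
      (fun x hx => ((h.hasDerivWithinAt_wronskian h' (hsub hx)).mono hsub).continuousWithinAt)
      (fun x hx => (h.hasDerivWithinAt_wronskian h' (hsub (interior_subset hx))).mono
        (interior_subset.trans hsub)) (fun x hx => by
          rw [interior_Icc] at hx
          exact mul_neg_of_neg_of_pos (sub_neg.2 hlt)
            (mul_pos (hpos x ⟨hx.1, hx.2.trans_le hc.2⟩) (hzc x hx)))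
    have := hanti ⟨le_rfl, hc.1.le⟩ ⟨hc.1.le, le_rfl⟩ hc.1
    simp only [hy, hu, hz, hw] at this
    linarith
  by_cases hzpos : ∀ x ∈ Ioo 0 Real.pi, 0 < z x
  · have h1 := hW Real.pi ⟨hπ, le_rfl⟩ hzpos
    have h2 := mul_eq_mul_of_cos_sin hF hF'
    linarith
  · push Not at hzpos
    obtain ⟨η, hη, r, hr, hnear⟩ := h'.exists_pos_near_zero hQ hγ hz hw
    have hnear' := hnear l z w h' hz hw (by simpa using hr)
    -- The search starts at `η` because `z 0` itself vanishes when `γ = π`.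
    set Z : Set ℝ := {x | x ∈ Icc η Real.pi ∧ z x ≤ 0} with hZ
    obtain ⟨x₁, hx₁, hzx₁⟩ := hzpos
    have hx₁Z : x₁ ∈ Z := by
      refine ⟨⟨?_, hx₁.2.le⟩, hzx₁⟩
      by_contra! hcon
      exact (hnear' x₁ ⟨hx₁.1, hcon.le⟩).not_ge hzx₁
    have hZclosed : IsClosed Z :=
      (h'.continuousOn_fst.mono (Icc_subset_Icc_left hη.1.le)).preimage_isClosed_of_isClosed
        isClosed_Icc isClosed_Iic
    have hZbdd : BddBelow Z := ⟨η, fun x hx => hx.1.1⟩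
    have hcZ : sInf Z ∈ Z := hZclosed.csInf_mem ⟨x₁, hx₁Z⟩ hZbdd
    set c := sInf Z
    have hc0 : 0 < c := hη.1.trans_le hcZ.1.1
    have hcπ : c < Real.pi := (csInf_le hZbdd hx₁Z).trans_lt hx₁.2
    have hzc : ∀ x ∈ Ioo 0 c, 0 < z x := by
      intro x hx
      by_contra! hcon
      rcases le_total x η with hxη | hxη
      · exact (hnear' x ⟨hx.1, hxη⟩).not_ge hcon
      · exact (csInf_le hZbdd (show x ∈ Z from ⟨⟨hxη, (hx.2.trans hcπ).le⟩, hcon⟩)).not_gt hx.2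
    have hzero : z c = 0 := by
      refine le_antisymm hcZ.2 ?_
      have hcont : ContinuousWithinAt z (Ioo 0 c) c :=
        (h'.continuousOn_fst c ⟨hc0.le, hcπ.le⟩).mono
          fun x hx => ⟨hx.1.le, (hx.2.trans hcπ).le⟩
      have : (𝓝[Ioo 0 c] c).NeBot := by
        rw [nhdsWithin_Ioo_eq_nhdsLT hc0]; infer_instance
      refine ge_of_tendsto hcont ?_
      filter_upwards [self_mem_nhdsWithin] with x hx using (hzc x hx).le
    have h1 := hW c ⟨hc0, hcπ.le⟩ hzc
    have h2 := nonpos_deriv_of_nonneg_left ⟨hc0, hcπ.le⟩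
      (h'.deriv_fst c ⟨hc0.le, hcπ.le⟩) hzero fun x hx => (hzc x hx).le
    rw [hzero, mul_zero, zero_add] at h2
    rw [hzero, mul_zero, zero_sub] at h1
    nlinarith [hpos c ⟨hc0, hcπ⟩]

/-- The parameter of a positive solution of the boundary value problem is below that of any other
nontrivial solution. -/
theorem le_of_sol {Q : ℝ → ℝ} (hQ : ContinuousOn Q (Icc 0 Real.pi)) {γ δ m l : ℝ}
    (hγ : γ ∈ Ioc 0 Real.pi) {y u z w : ℝ → ℝ} (h : Sol Q m y u)
    (hy : y 0 = Real.sin γ) (hu : u 0 = -Real.cos γ) (hpos : ∀ x ∈ Ioo 0 Real.pi, 0 < y x)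
    (hF : rightForm Q δ y u = 0) (h' : Sol Q l z w)
    (hzw : z 0 * Real.cos γ + w 0 * Real.sin γ = 0) (hF' : rightForm Q δ z w = 0)
    (hne : ∃ x ∈ Icc 0 Real.pi, z x ≠ 0) : m ≤ l := by
  have hsc := Real.sin_sq_add_cos_sq γ
  -- The left condition forces `(z 0, w 0) = c (sin γ, -cos γ)`.
  set c := z 0 * Real.sin γ - w 0 * Real.cos γ with hc
  have hz0 : z 0 = c * Real.sin γ := by
    rw [hc]; linear_combination Real.cos γ * hzw - z 0 * hsc
  have hw0 : w 0 = -(c * Real.cos γ) := by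
    rw [hc]; linear_combination Real.sin γ * hzw - w 0 * hsc
  have hc0 : c ≠ 0 := by
    intro hc0
    obtain ⟨x, hx, hzx⟩ := hne
    exact hzx (h'.eq_zero hQ ⟨le_rfl, Real.pi_pos.le⟩ (by simp [hz0, hc0])
      (by simp [hw0, hc0]) x hx).1
  refine le_of_normalized_sol hQ hγ h hy hu hpos hF (h'.const_mul c⁻¹) ?_ ?_ ?_
  · rw [hz0]; field_simp
  · rw [hw0]; field_simp
  · simp only [rightForm] at hF' ⊢
    linear_combination c⁻¹ * hF'

/-! ### Absolute continuity and the primitive of the potential. -/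

section AbsolutelyContinuous

variable {X Y : Type*} [PseudoMetricSpace X] [PseudoMetricSpace Y] {a b : ℝ}

theorem absolutelyContinuousOnInterval_comp {f : ℝ → X} {g : X → Y} (hg : LipschitzWith 1 g)
    (hf : AbsolutelyContinuousOnInterval f a b) :
    AbsolutelyContinuousOnInterval (fun x => g (f x)) a b := by
  rw [absolutelyContinuousOnInterval_iff] at hf ⊢
  intro ε hε
  obtain ⟨η, hη, h⟩ := hf ε hε
  refine ⟨η, hη, fun E hE hlt => lt_of_le_of_lt ?_ (h E hE hlt)⟩
  exact Finset.sum_le_sum fun i _ => by simpa using hg.dist_le_mul (f (E.2 i).1) (f (E.2 i).2)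

theorem absolutelyContinuousOnInterval_congr {f g : ℝ → X}
    (hf : AbsolutelyContinuousOnInterval f a b) (h : EqOn f g (uIcc a b)) :
    AbsolutelyContinuousOnInterval g a b := by
  rw [absolutelyContinuousOnInterval_iff] at hf ⊢
  intro ε hε
  obtain ⟨η, hη, h'⟩ := hf ε hε
  refine ⟨η, hη, fun E hE hlt => lt_of_eq_of_lt ?_ (h' E hE hlt)⟩
  exact Finset.sum_congr rfl fun i hi => by rw [h (hE.1 i hi).1, h (hE.1 i hi).2]

theorem absolutelyContinuousOnInterval_of_hasDerivWithinAt {E : Type*} [NormedAddCommGroup E]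
    [NormedSpace ℝ E] {f f' : ℝ → E} (hab : a ≤ b)
    (hf : ∀ x ∈ Icc a b, HasDerivWithinAt f (f' x) (Icc a b) x)
    (hf' : ContinuousOn f' (Icc a b)) : AbsolutelyContinuousOnInterval f a b := by
  obtain ⟨C, hC⟩ := isCompact_Icc.exists_bound_of_continuousOn hf'
  have := (convex_Icc a b).lipschitzOnWith_of_nnnorm_hasDerivWithin_le (C := C.toNNReal) hf
    fun x hx => NNReal.le_toNNReal_of_coe_le (hC x hx)
  rw [← uIcc_of_le hab] at this
  exact this.absolutelyContinuousOnInterval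

end AbsolutelyContinuous

/-- The primitive of `q` that vanishes at `0`. -/
noncomputable def primitive (q : ℝ → ℝ) (x : ℝ) : ℝ := ∫ t in (0 : ℝ)..x, q t

theorem primitive_self_zero (q : ℝ → ℝ) : primitive q 0 = 0 := by simp [primitive]

theorem intervalIntegrable_potential {q : ℝ → ℝ}
    (hq : IntegrableOn q (Ioo 0 Real.pi) volume) :
    IntervalIntegrable q volume 0 Real.pi :=
  (intervalIntegrable_iff_integrableOn_Ioo_of_le Real.pi_pos.le).2 hq

theorem absolutelyContinuousOnInterval_primitive {q : ℝ → ℝ}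
    (hq : IntegrableOn q (Ioo 0 Real.pi) volume) :
    AbsolutelyContinuousOnInterval (primitive q) 0 Real.pi :=
  (intervalIntegrable_potential hq).absolutelyContinuousOnInterval_intervalIntegral left_mem_uIcc

theorem continuousOn_primitive {q : ℝ → ℝ}
    (hq : IntegrableOn q (Ioo 0 Real.pi) volume) :
    ContinuousOn (primitive q) (Icc 0 Real.pi) := by
  have := (absolutelyContinuousOnInterval_primitive hq).continuousOn
  rwa [uIcc_of_le Real.pi_pos.le] at this

theorem ae_hasDerivAt_primitive {q : ℝ → ℝ}
    (hq : IntegrableOn q (Ioo 0 Real.pi) volume) :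
    ∀ᵐ x, x ∈ Icc 0 Real.pi → HasDerivAt (primitive q) (q x) x := by
  have := (intervalIntegrable_potential hq).ae_hasDerivAt_integral
  rw [uIcc_of_le Real.pi_pos.le] at this
  filter_upwards [this] with x hx hx'
  exact hx hx' 0 ⟨le_rfl, Real.pi_pos.le⟩

theorem ae_vol_iff {p : ℝ → Prop} : (∀ᵐ x ∂vol, p x) ↔ ∀ᵐ x, x ∈ Ioo 0 Real.pi → p x :=
  ae_restrict_iff' measurableSet_Ioo

theorem Sol.absolutelyContinuousOnInterval_fst {Q : ℝ → ℝ} (hQ : ContinuousOn Q (Icc 0 Real.pi))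
    {l : ℝ} {y u : ℝ → ℝ} (h : Sol Q l y u) : AbsolutelyContinuousOnInterval y 0 Real.pi :=
  absolutelyContinuousOnInterval_of_hasDerivWithinAt Real.pi_pos.le h.deriv_fst
    ((hQ.mul h.continuousOn_fst).add h.continuousOn_snd)

theorem Sol.absolutelyContinuousOnInterval_snd {Q : ℝ → ℝ} (hQ : ContinuousOn Q (Icc 0 Real.pi))
    {l : ℝ} {y u : ℝ → ℝ} (h : Sol Q l y u) : AbsolutelyContinuousOnInterval u 0 Real.pi :=
  absolutelyContinuousOnInterval_of_hasDerivWithinAt Real.pi_pos.le h.deriv_snd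
    (((continuousOn_const.add (hQ.pow 2)).neg.mul h.continuousOn_fst).sub
      (hQ.mul h.continuousOn_snd))

/-- The derivative `y' = Q y + u` of a solution is absolutely continuous. -/
theorem Sol.absolutelyContinuousOnInterval_deriv {Q : ℝ → ℝ}
    (hQ : AbsolutelyContinuousOnInterval Q 0 Real.pi) {l : ℝ} {y u : ℝ → ℝ} (h : Sol Q l y u) :
    AbsolutelyContinuousOnInterval (fun x => Q x * y x + u x) 0 Real.pi := by
  have hQc := hQ.continuousOn
  rw [uIcc_of_le Real.pi_pos.le] at hQc
  exact (hQ.mul (h.absolutelyContinuousOnInterval_fst hQc)).add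
    (h.absolutelyContinuousOnInterval_snd hQc)

/-- Differentiating `Q y + u` cancels every term in `Q`; only `Q' = q` survives, which recovers `y''
= (q - l) y`. -/
theorem Sol.hasDerivAt_deriv {Q : ℝ → ℝ} {l : ℝ} {y u : ℝ → ℝ} (h : Sol Q l y u) {x q : ℝ}
    (hx : x ∈ Ioo 0 Real.pi) (hQ : HasDerivAt Q q x) :
    HasDerivAt (fun x => Q x * y x + u x) ((q - l) * y x) x := by
  have hnhds := Icc_mem_nhds hx.1 hx.2
  have hx' := Ioo_subset_Icc_self hx
  refine ((hQ.mul ((h.deriv_fst x hx').hasDerivAt hnhds)).add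
    ((h.deriv_snd x hx').hasDerivAt hnhds)).congr_deriv ?_
  ring

/-! ### From the system to the operator and back. -/

theorem isEigenvalue_of_sol {q : ℝ → ℝ} (hq : IntegrableOn q (Ioo 0 Real.pi) volume) {γ δ m : ℝ}
    {y u : ℝ → ℝ} (h : Sol (primitive q) m y u) (hl : y 0 * Real.cos γ + u 0 * Real.sin γ = 0)
    (hr : rightForm (primitive q) δ y u = 0) (hne : ∃ x ∈ Icc 0 Real.pi, y x ≠ 0) :
    IsEigenvalue q γ δ m := by
  have hπ := Real.pi_pos
  set Q := primitive q with hQ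
  set Y : ℝ → ℂ := fun x => (y x : ℂ) with hY
  have hYd : ∀ x ∈ Icc 0 Real.pi,
      HasDerivWithinAt Y ((Q x * y x + u x : ℝ) : ℂ) (Icc 0 Real.pi) x := fun x hx =>
    (h.deriv_fst x hx).ofReal_comp
  have hD : ∀ x ∈ Icc 0 Real.pi, D Y x = ((Q x * y x + u x : ℝ) : ℂ) := fun x hx =>
    (hYd x hx).derivWithin (uniqueDiffOn_Icc hπ x hx)
  have hexpr : ∀ᵐ x ∂vol, expr q Y x = (m : ℂ) * Y x := by
    rw [ae_vol_iff]
    filter_upwards [ae_hasDerivAt_primitive hq] with x hx hx'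
    have h1 := (h.hasDerivAt_deriv hx' (hx (Ioo_subset_Icc_self hx'))).ofReal_comp
    have h2 : D Y =ᶠ[𝓝 x] fun x => ((Q x * y x + u x : ℝ) : ℂ) := by
      filter_upwards [Icc_mem_nhds hx'.1 hx'.2] with t ht using hD t ht
    rw [expr, h2.deriv_eq, h1.deriv]
    simp only [hY]
    push_cast
    ring
  refine ⟨Y, ⟨fun x hx => (hYd x hx).differentiableWithinAt, ?_, ?_, ?_, ?_⟩, ?_, hexpr⟩
  · refine absolutelyContinuousOnInterval_congr (absolutelyContinuousOnInterval_comp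
      Complex.isometry_ofReal.lipschitz
      (h.absolutelyContinuousOnInterval_deriv (absolutelyContinuousOnInterval_primitive hq)))
      fun x hx => ?_
    rw [uIcc_of_le hπ.le] at hx
    exact (hD x hx).symm
  · refine (memLp_congr_ae hexpr).2 ?_
    have hYc : ContinuousOn (fun x => (m : ℂ) * Y x) (Icc 0 Real.pi) :=
      continuousOn_const.mul fun x hx => (hYd x hx).continuousWithinAt
    obtain ⟨C, hC⟩ := isCompact_Icc.exists_bound_of_continuousOn hYc
    have : IsFiniteMeasure vol := by unfold vol; infer_instance
    refine MemLp.of_bound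
      ((hYc.mono Ioo_subset_Icc_self).aestronglyMeasurable measurableSet_Ioo) C ?_
    rw [ae_vol_iff]
    exact Eventually.of_forall fun x hx => hC x (Ioo_subset_Icc_self hx)
  · rw [hD 0 ⟨le_rfl, hπ.le⟩, hQ, primitive_self_zero, zero_mul, zero_add]
    simp only [hY]
    exact_mod_cast hl
  · rw [hD _ ⟨hπ.le, le_rfl⟩]
    simp only [hY]
    simp only [rightForm] at hr
    exact_mod_cast hr
  · obtain ⟨x, hx, hyx⟩ := hne
    exact ⟨x, hx, by simpa [hY] using hyx⟩

/-- An eigenfunction and its quasi-derivative solve a system with continuous coefficients. -/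
theorem InDomain.exists_quasiDeriv {q : ℝ → ℝ} (hq : IntegrableOn q (Ioo 0 Real.pi) volume)
    {γ δ : ℝ} {μ : ℂ} {z : ℝ → ℂ} (hz : InDomain q γ δ z)
    (hμ : ∀ᵐ x ∂vol, expr q z x = μ * z x) :
    ∃ U : ℝ → ℂ, (∀ x ∈ Icc 0 Real.pi, D z x = primitive q x * z x + U x) ∧
      (∀ x ∈ Icc 0 Real.pi,
        HasDerivWithinAt z (primitive q x * z x + U x) (Icc 0 Real.pi) x) ∧
      ∀ x ∈ Icc 0 Real.pi, HasDerivWithinAt U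
        (-(μ + (primitive q x : ℂ) ^ 2) * z x - primitive q x * U x) (Icc 0 Real.pi) x := by
  have hπ := Real.pi_pos
  have hI : uIcc 0 Real.pi = Icc 0 Real.pi := uIcc_of_le hπ.le
  set Q := primitive q with hQ
  set U : ℝ → ℂ := fun x => D z x - (Q x : ℂ) * z x with hU
  have hzd : ∀ x ∈ Icc 0 Real.pi, HasDerivWithinAt z (D z x) (Icc 0 Real.pi) x :=
    fun x hx => (hz.differentiableOn x hx).hasDerivWithinAt
  have hDac := hz.absolutelyContinuous
  have hDc : ContinuousOn (D z) (Icc 0 Real.pi) := hI ▸ hDac.continuousOn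
  have hzc : ContinuousOn z (Icc 0 Real.pi) := fun x hx => (hzd x hx).continuousWithinAt
  have hzac := absolutelyContinuousOnInterval_of_hasDerivWithinAt hπ.le hzd hDc
  have hQac : AbsolutelyContinuousOnInterval (fun x => (Q x : ℂ)) 0 Real.pi :=
    absolutelyContinuousOnInterval_comp Complex.isometry_ofReal.lipschitz
      (absolutelyContinuousOnInterval_primitive hq)
  have hQc : ContinuousOn (fun x => (Q x : ℂ)) (Icc 0 Real.pi) := hI ▸ hQac.continuousOn
  have hUac : AbsolutelyContinuousOnInterval U 0 Real.pi := hDac.sub (hQac.smul hzac)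
  have hUc : ContinuousOn U (Icc 0 Real.pi) := hI ▸ hUac.continuousOn
  set H : ℝ → ℂ := fun x => -(μ + (Q x : ℂ) ^ 2) * z x - Q x * U x with hH
  have hHc : ContinuousOn H (Icc 0 Real.pi) :=
    ((continuousOn_const.add (hQc.pow 2)).neg.mul hzc).sub (hQc.mul hUc)
  -- `H` is the derivative expected of `U`. Since `U - G` is absolutely continuous with zero
  -- derivative a.e., it is constant, which upgrades the a.e. equation to differentiability of `U`
  -- at every point.
  set G : ℝ → ℂ := fun x => ∫ t in (0 : ℝ)..x, H t with hG
  have hGd : ∀ x ∈ Icc 0 Real.pi, HasDerivWithinAt G (H x) (Icc 0 Real.pi) x := by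
    intro x hx
    have : Fact (x ∈ Icc 0 Real.pi) := ⟨hx⟩
    refine intervalIntegral.integral_hasDerivWithinAt_right ?_
      (hHc.stronglyMeasurableAtFilter_nhdsWithin measurableSet_Icc x) (hHc x hx)
    refine (hHc.mono ?_).intervalIntegrable
    rw [uIcc_of_le hx.1]
    exact Icc_subset_Icc_right hx.2
  have hGac := absolutelyContinuousOnInterval_of_hasDerivWithinAt hπ.le hGd hHc
  have hre := (absolutelyContinuousOnInterval_comp (LipschitzWith.of_dist_le_mul (K := 1)
    fun a b => by simpa [dist_eq_norm] using Complex.abs_re_le_norm (a - b)) hDac :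
      AbsolutelyContinuousOnInterval (fun x => (D z x).re) 0 Real.pi).ae_differentiableAt
  have him := (absolutelyContinuousOnInterval_comp (LipschitzWith.of_dist_le_mul (K := 1)
    fun a b => by simpa [dist_eq_norm] using Complex.abs_im_le_norm (a - b)) hDac :
      AbsolutelyContinuousOnInterval (fun x => (D z x).im) 0 Real.pi).ae_differentiableAt
  have h0 : ∀ᵐ x : ℝ, x ≠ 0 := by simp [ae_iff, measure_singleton]
  have h1 : ∀ᵐ x : ℝ, x ≠ Real.pi := by simp [ae_iff, measure_singleton]
  obtain ⟨C, hC⟩ := (hUac.sub hGac).const_of_ae_hasDerivAt_zero (by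
    rw [ae_vol_iff] at hμ
    filter_upwards [hre, him, h0, h1, hμ, ae_hasDerivAt_primitive hq] with
      x hxre hxim hx0 hxπ hxμ hxQ hx
    have hx' : x ∈ Icc 0 Real.pi := hI ▸ hx
    have hxo : x ∈ Ioo 0 Real.pi := ⟨hx'.1.lt_of_ne' hx0, hx'.2.lt_of_ne hxπ⟩
    have hnhds := Icc_mem_nhds hxo.1 hxo.2
    -- `deriv` is `0` by default where `D z` is not differentiable, so the eigenvalue equation gives
    -- a genuine derivative only together with this.
    have hDdiff : DifferentiableAt ℝ (D z) x := by
      have := ((hxre hx).hasDerivAt.ofReal_comp.add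
        ((hxim hx).hasDerivAt.ofReal_comp.mul_const Complex.I)).differentiableAt
      refine this.congr_of_eventuallyEq (Eventually.of_forall fun t => ?_)
      simp [Complex.re_add_im]
    have hDder : deriv (D z) x = ((q x : ℂ) - μ) * z x := by
      have := hxμ hxo
      rw [expr] at this
      linear_combination -this
    refine ((hDdiff.hasDerivAt.sub ((hxQ hx').ofReal_comp.mul
      ((hzd x hx').hasDerivAt hnhds))).sub ((hGd x hx').hasDerivAt hnhds)).congr_deriv ?_
    rw [hDder]
    simp only [hH, hU]
    ring)
  have hUd : ∀ x ∈ Icc 0 Real.pi, HasDerivWithinAt U (H x) (Icc 0 Real.pi) x := by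
    intro x hx
    refine ((hGd x hx).const_add C).congr (fun t ht => ?_) ?_
    · have := hC t (hI ▸ ht)
      simp only [Pi.sub_apply] at this
      linear_combination this
    · have := hC x (hI ▸ hx)
      simp only [Pi.sub_apply] at this
      linear_combination this
  refine ⟨U, fun x _ => by simp only [hU]; ring, fun x hx => ?_, hUd⟩
  refine (hzd x hx).congr_deriv ?_
  simp only [hU]
  ring

theorem hasDerivWithinAt_re {f : ℝ → ℂ} {f' : ℂ} {s : Set ℝ} {x : ℝ}
    (h : HasDerivWithinAt f f' s x) : HasDerivWithinAt (fun x => (f x).re) f'.re s x :=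
  Complex.reCLM.hasFDerivAt.comp_hasDerivWithinAt x h

theorem hasDerivWithinAt_im {f : ℝ → ℂ} {f' : ℂ} {s : Set ℝ} {x : ℝ}
    (h : HasDerivWithinAt f f' s x) : HasDerivWithinAt (fun x => (f x).im) f'.im s x :=
  Complex.imCLM.hasFDerivAt.comp_hasDerivWithinAt x h

/-- Eigenvalues are real, and not below the parameter of a positive solution. -/
theorem IsEigenvalue.im_eq_zero_and_le {q : ℝ → ℝ}
    (hq : IntegrableOn q (Ioo 0 Real.pi) volume) {γ δ m : ℝ} (hγ : γ ∈ Ioc 0 Real.pi)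
    {y u : ℝ → ℝ} (h : Sol (primitive q) m y u) (hy : y 0 = Real.sin γ)
    (hu : u 0 = -Real.cos γ) (hpos : ∀ x ∈ Ioo 0 Real.pi, 0 < y x)
    (hF : rightForm (primitive q) δ y u = 0) {μ : ℂ} (hμ : IsEigenvalue q γ δ μ) :
    μ.im = 0 ∧ m ≤ μ.re := by
  obtain ⟨z, hz, ⟨x₀, hx₀, hzx₀⟩, hexpr⟩ := hμ
  obtain ⟨U, hDU, hzd, hUd⟩ := hz.exists_quasiDeriv hq hexpr
  have hQc := continuousOn_primitive hq
  have hπ := Real.pi_pos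
  have h0 : (0 : ℝ) ∈ Icc 0 Real.pi := ⟨le_rfl, hπ.le⟩
  have hπI : Real.pi ∈ Icc 0 Real.pi := ⟨hπ.le, le_rfl⟩
  have hleft := hz.boundary_left
  have hright := hz.boundary_right
  rw [hDU 0 h0, primitive_self_zero, Complex.ofReal_zero, zero_mul, zero_add] at hleft
  rw [hDU _ hπI] at hright
  set Q := primitive q with hQ
  have hleft_re := congrArg Complex.re hleft
  have hleft_im := congrArg Complex.im hleft
  have hright_re := congrArg Complex.re hright
  have hright_im := congrArg Complex.im hright
  simp only [Complex.add_re, Complex.mul_re, Complex.add_im, Complex.mul_im, Complex.ofReal_re,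
    Complex.ofReal_im, mul_zero, zero_mul, sub_zero, zero_add, add_zero, Complex.zero_re,
    Complex.zero_im] at hleft_re hleft_im hright_re hright_im
  have hreal : μ.im = 0 := by
    by_contra hb
    -- Up to a factor this is the Wronskian of the imaginary and real parts of `z`. It vanishes at
    -- both ends because the boundary conditions are real, yet its derivative is `(Im μ)² |z|²`.
    have hd : ∀ x ∈ Icc 0 Real.pi, HasDerivWithinAt
        (fun x => -μ.im * ((U x).im * (z x).re - (U x).re * (z x).im))
        (μ.im ^ 2 * ((z x).re ^ 2 + (z x).im ^ 2)) (Icc 0 Real.pi) x := by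
      intro x hx
      refine ((((hasDerivWithinAt_im (hUd x hx)).mul (hasDerivWithinAt_re (hzd x hx))).sub
        ((hasDerivWithinAt_re (hUd x hx)).mul (hasDerivWithinAt_im (hzd x hx)))).const_mul
          (-μ.im)).congr_deriv ?_
      simp only [Complex.sub_re, Complex.sub_im, Complex.neg_re, Complex.neg_im,
        Complex.add_re, Complex.mul_re, Complex.add_im, Complex.mul_im, Complex.ofReal_re,
        Complex.ofReal_im, pow_two]
      ring
    have hmono := monotoneOn_of_hasDerivWithinAt_nonneg (convex_Icc 0 Real.pi)
      (fun x hx => (hd x hx).continuousWithinAt)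
      (fun x hx => (hd x (interior_subset hx)).mono interior_subset)
      (fun x hx => by positivity)
    have hl0 := mul_eq_mul_of_cos_sin hleft_im hleft_re
    have hr0 := mul_eq_mul_of_cos_sin hright_im hright_re
    have hzero : ∀ x ∈ Icc 0 Real.pi,
        -μ.im * ((U x).im * (z x).re - (U x).re * (z x).im) = 0 := by
      intro x hx
      have h1 := hmono h0 hx hx.1
      have h2 := hmono hx hπI hx.2
      have h3 : (U 0).im * (z 0).re - (U 0).re * (z 0).im = 0 := by linarith
      have h4 : (U Real.pi).im * (z Real.pi).re - (U Real.pi).re * (z Real.pi).im = 0 := by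
        linarith
      simp only [h3, h4, mul_zero] at h1 h2
      exact le_antisymm h2 h1
    have h5 : HasDerivWithinAt (fun x => -μ.im * ((U x).im * (z x).re - (U x).re * (z x).im))
        0 (Icc 0 Real.pi) x₀ :=
      (hasDerivWithinAt_const x₀ _ (0 : ℝ)).congr (fun t ht => hzero t ht) (hzero x₀ hx₀)
    have h6 := (uniqueDiffOn_Icc hπ x₀ hx₀).eq_deriv _ (hd x₀ hx₀) h5
    have h7 : (z x₀).re ^ 2 + (z x₀).im ^ 2 = 0 :=
      (mul_eq_zero.1 h6).resolve_left (pow_ne_zero 2 hb)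
    refine hzx₀ (Complex.ext ?_ ?_) <;>
      simp only [Complex.zero_re, Complex.zero_im] <;>
      nlinarith [sq_nonneg (z x₀).re, sq_nonneg (z x₀).im]
  refine ⟨hreal, ?_⟩
  -- For real `μ` the real and imaginary parts solve the problem separately, and one of them is
  -- nontrivial.
  by_cases hre : (z x₀).re = 0
  · have him : (z x₀).im ≠ 0 := fun him => hzx₀ (Complex.ext hre him)
    refine le_of_sol (z := fun x => (z x).im) (w := fun x => (U x).im) hQc hγ h hy hu hpos hF
      ⟨fun x hx => ?_, fun x hx => ?_⟩ hleft_im hright_im ⟨x₀, hx₀, him⟩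
    · refine (hasDerivWithinAt_im (hzd x hx)).congr_deriv ?_
      simp
    · refine (hasDerivWithinAt_im (hUd x hx)).congr_deriv ?_
      simp [hreal, pow_two]
  · refine le_of_sol (z := fun x => (z x).re) (w := fun x => (U x).re) hQc hγ h hy hu hpos hF
      ⟨fun x hx => ?_, fun x hx => ?_⟩ hleft_re hright_re ⟨x₀, hx₀, hre⟩
    · refine (hasDerivWithinAt_re (hzd x hx)).congr_deriv ?_
      simp
    · refine (hasDerivWithinAt_re (hUd x hx)).congr_deriv ?_
      simp [hreal, pow_two]

/-! ### Ground states and the comparison of two potentials. -/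

/-- The lowest eigenvalue exists and has a positive eigenfunction. -/
theorem exists_ground_state {q : ℝ → ℝ} (hq : IntegrableOn q (Ioo 0 Real.pi) volume) {γ δ : ℝ}
    (hγ : γ ∈ Ioc 0 Real.pi) (hδ : δ ∈ Ico 0 Real.pi) :
    IsLowestEigenvalue q γ δ (mu0 q γ δ) ∧
    ∃ y u, Sol (primitive q) (mu0 q γ δ) y u ∧ y 0 = Real.sin γ ∧ u 0 = -Real.cos γ ∧
      (∀ x ∈ Ioo 0 Real.pi, 0 < y x) ∧ rightForm (primitive q) δ y u = 0 := by
  obtain ⟨m, y, u, h, hy, hu, hpos, hF⟩ := exists_pos_eigenpair (continuousOn_primitive hq) hγ hδ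
  have hπ2 : Real.pi / 2 ∈ Ioo 0 Real.pi := ⟨Real.pi_div_two_pos, half_lt_self Real.pi_pos⟩
  have hlow : IsLowestEigenvalue q γ δ m :=
    ⟨isEigenvalue_of_sol hq h (by rw [hy, hu]; ring) hF
      ⟨_, Ioo_subset_Icc_self hπ2, (hpos _ hπ2).ne'⟩,
      fun μ hμ => hμ.im_eq_zero_and_le hq hγ h hy hu hpos hF⟩
  have hm : mu0 q γ δ = m :=
    IsLeast.csInf_eq ⟨hlow.1, fun l hl => by simpa using (hlow.2 l hl).2⟩
  rw [hm]
  exact ⟨hlow, y, u, h, hy, hu, hpos, hF⟩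

/-- Orthogonality relation between solutions of boundary value problems with two potentials. -/
theorem integral_potential_diff_eq_zero {p q : ℝ → ℝ}
    (hp : IntegrableOn p (Ioo 0 Real.pi) volume) (hq : IntegrableOn q (Ioo 0 Real.pi) volume)
    {γ δ l m : ℝ} {y u z w : ℝ → ℝ} (h : Sol (primitive q) m y u) (h' : Sol (primitive p) l z w)
    (hl : y 0 * Real.cos γ + u 0 * Real.sin γ = 0) (hl' : z 0 * Real.cos γ + w 0 * Real.sin γ = 0)
    (hr : rightForm (primitive q) δ y u = 0) (hr' : rightForm (primitive p) δ z w = 0) :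
    IntegrableOn (fun x => (q x - p x - (m - l)) * (y x * z x)) (Ioo 0 Real.pi) volume ∧
    ∫ x in Ioo 0 Real.pi, (q x - p x - (m - l)) * (y x * z x) = 0 := by
  have hπ := Real.pi_pos
  -- The Wronskian is formed with the true derivatives, since the two quasi-derivatives refer to
  -- different primitives.
  set W : ℝ → ℝ := fun x =>
    (primitive q x * y x + u x) * z x - y x * (primitive p x * z x + w x) with hW
  have hQ := absolutelyContinuousOnInterval_primitive hq
  have hP := absolutelyContinuousOnInterval_primitive hp
  have hWac : AbsolutelyContinuousOnInterval W 0 Real.pi :=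
    ((h.absolutelyContinuousOnInterval_deriv hQ).mul
      (h'.absolutelyContinuousOnInterval_fst (continuousOn_primitive hp))).sub
    ((h.absolutelyContinuousOnInterval_fst (continuousOn_primitive hq)).mul
      (h'.absolutelyContinuousOnInterval_deriv hP))
  have hae : (fun x => deriv W x) =ᵐ[volume.restrict (Ioo 0 Real.pi)]
      fun x => (q x - p x - (m - l)) * (y x * z x) := by
    refine (ae_restrict_iff' measurableSet_Ioo).2 ?_
    filter_upwards [ae_hasDerivAt_primitive hq, ae_hasDerivAt_primitive hp] with x hxq hxp hx
    have hx' := Ioo_subset_Icc_self hx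
    have hnhds := Icc_mem_nhds hx.1 hx.2
    have : HasDerivAt W ((q x - p x - (m - l)) * (y x * z x)) x := by
      refine (((h.hasDerivAt_deriv hx (hxq hx')).mul
        ((h'.deriv_fst x hx').hasDerivAt hnhds)).sub
        (((h.deriv_fst x hx').hasDerivAt hnhds).mul
          (h'.hasDerivAt_deriv hx (hxp hx')))).congr_deriv ?_
      ring
    exact this.deriv
  have hint : IntegrableOn (deriv W) (Ioo 0 Real.pi) volume :=
    (intervalIntegrable_iff_integrableOn_Ioo_of_le hπ.le).1 hWac.intervalIntegrable_deriv
  refine ⟨hint.congr hae, ?_⟩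
  have h1 := hWac.integral_deriv_eq_sub
  rw [intervalIntegral.integral_of_le hπ.le, integral_Ioc_eq_integral_Ioo,
    integral_congr_ae hae] at h1
  have h2 := mul_eq_mul_of_cos_sin hl hl'
  have h3 := mul_eq_mul_of_cos_sin hr hr'
  rw [h1]
  simp only [hW, primitive_self_zero]
  linarith

theorem not_ae_pos_of_integral_eq_zero {f g : ℝ → ℝ} (hg : ∀ x ∈ Ioo 0 Real.pi, 0 < g x)
    (hi : IntegrableOn (fun x => f x * g x) (Ioo 0 Real.pi) volume)
    (h0 : ∫ x in Ioo 0 Real.pi, f x * g x = 0) : ¬ ∀ᵐ x ∂vol, 0 < f x := by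
  intro hf
  have hfg : ∀ᵐ x ∂vol, 0 < f x * g x := by
    rw [ae_vol_iff] at hf ⊢
    filter_upwards [hf] with x hx hx' using mul_pos (hx hx') (hg x hx')
  have h1 := (integral_eq_zero_iff_of_nonneg_ae (hfg.mono fun x hx => hx.le) hi).1 h0
  have h2 : ∀ᵐ _ ∂vol, False := by
    filter_upwards [hfg, h1] with x hx hx'
    exact hx.ne' hx'
  rw [ae_vol_iff] at h2
  have h3 : volume (Ioo 0 Real.pi) = 0 := by
    simp only [ae_iff, imp_false, not_not] at h2
    exact h2
  simp [Real.volume_Ioo, Real.pi_pos.not_ge] at h3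

end SturmLiouville

theorem theorem3p1 (q : ℝ → ℝ) (hq : IntegrableOn q (Set.Ioo 0 Real.pi) volume)
    (γ δ : ℝ) (hγ : γ ∈ Set.Ioc 0 Real.pi) (hδ : δ ∈ Set.Ico 0 Real.pi) :
    SturmLiouville.IsLowestEigenvalue q γ δ (SturmLiouville.mu0 q γ δ) ∧
    SturmLiouville.IsLowestEigenvalue 0 γ δ (SturmLiouville.mu0 0 γ δ) ∧
    essInf (fun x => (q x : EReal)) SturmLiouville.vol ≤
      ((SturmLiouville.mu0 q γ δ - SturmLiouville.mu0 0 γ δ : ℝ) : EReal) ∧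
    ((SturmLiouville.mu0 q γ δ - SturmLiouville.mu0 0 γ δ : ℝ) : EReal) ≤
      essSup (fun x => (q x : EReal)) SturmLiouville.vol := by
  have h0 : IntegrableOn (0 : ℝ → ℝ) (Set.Ioo 0 Real.pi) volume := integrable_zero _ _ _
  obtain ⟨hlow, y, u, h, hy, hu, hpos, hF⟩ := SturmLiouville.exists_ground_state hq hγ hδ
  obtain ⟨hlow', z, w, h', hz, hw, hpos', hF'⟩ := SturmLiouville.exists_ground_state h0 hγ hδ
  obtain ⟨hi, hint⟩ := SturmLiouville.integral_potential_diff_eq_zero (γ := γ) h0 hq h h'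
    (by rw [hy, hu]; ring) (by rw [hz, hw]; ring) hF hF'
  have hyz : ∀ x ∈ Set.Ioo 0 Real.pi, 0 < y x * z x := fun x hx => mul_pos (hpos x hx) (hpos' x hx)
  refine ⟨hlow, hlow', ?_, ?_⟩
  -- If the difference of eigenvalues were below the essential infimum, the integrand of zero
  -- integral would be positive a.e.; the upper bound is the same argument with the sign reversed.
  · by_contra! hlt
    refine SturmLiouville.not_ae_pos_of_integral_eq_zero hyz hi hint ?_
    filter_upwards [ae_lt_of_lt_essInf hlt] with x hx
    have := EReal.coe_lt_coe_iff.1 hx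
    simpa using this
  · by_contra! hlt
    refine SturmLiouville.not_ae_pos_of_integral_eq_zero
      (f := fun x => -(q x - (0 : ℝ → ℝ) x - (SturmLiouville.mu0 q γ δ -
        SturmLiouville.mu0 0 γ δ))) hyz
      (by simp only [neg_mul]; exact hi.neg) (by simp only [neg_mul, integral_neg, hint, neg_zero])
      ?_
    filter_upwards [ae_lt_of_essSup_lt hlt] with x hx
    have := EReal.coe_lt_coe_iff.1 hx
    simpa using this
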